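/- All categories and functors are additive (an additive category is a preadditive category with all finite direct sums, including a zero object). For an additive category $B$ let $\mathrm{Kar}(B)$ be its idempotent completion: its objects are the pairs $(X,p)$ with $X\in B$, $p\colon X\to X$, $p^2=p$, and a morphism $(X,p)\to(X',p')$ is an $f\in B(X,X')$ with $p'f=fp=f$. Let $\mathrm{Wkar}(B)$ be the full subcategory of $\mathrm{Kar}(B)$ whose objects are those $Z$ for which there exist $X,Y\in B$ with $(X,\mathrm{id}_X)\oplus Z\cong (Y,\mathrm{id}_Y)$ in $\mathrm{Kar}(B)$; the assignment $X\mapsto (X,\mathrm{id}_X)$ defines the canonical embedding $B\to \mathrm{Wkar}(B)$. Let $K^b(B)$ be the homotopy category of bounded complexes over $B$. For an essentially small $B$ the split Grothendieck group $K_0^{\mathrm{add}}(B)$ is the abelian group generated by the isomorphism classes of objects of $B$, with the relations $[Y]=[X]+[Z]$ whenever $Y\cong X\oplus Z$. Let $F\colon B\to B'$ be a fully faithful additive functor between additive categories (for example, the inclusion of a full additive subcategory $B\subset B'$). (1) The induced functor $K^b(B)\to K^b(B')$ is an equivalence of categories if and only if the canonical embedding $B\to \mathrm{Wkar}(B)$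 factors (up to isomorphism of functors) as $G\circ F$ for some fully faithful additive functor $G\colon B'\to \mathrm{Wkar}(B)$. (2) Consequently, if $B'$ is essentially small and the canonical embedding $B\to\mathrm{Wkar}(B)$ factors as in (1) (that is, $B\subset B'\subset \mathrm{Wkar}(B)$ via full embeddings), then the homomorphism $K_0^{\mathrm{add}}(B)\to K_0^{\mathrm{add}}(B')$, $[X]\mapsto[F(X)]$, is bijective. -/

import Mathlib

open CategoryTheory CategoryTheory.Limits CategoryTheory.Idempotents

universe w v₁ v₂ u₁ u₂

noncomputable section

namespace WeakIdem

attribute [local instance] hasBinaryBiproducts_of_finite_biproducts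

section Bounded

variable (C : Type u₁) [Category.{v₁} C] [Preadditive C]

/-- The property of objects in the homotopy category of cochain complexes (indexed by `ℤ`) over
`C` whose underlying complex is bounded: its terms are zero objects outside a finite interval. -/
def bounded : ObjectProperty (HomotopyCategory C (ComplexShape.up ℤ)) :=
  fun K => ∃ a b : ℤ, ∀ i : ℤ, (i < a ∨ b < i) → IsZero (K.as.X i)

/-- The bounded homotopy category `K^b(C)`: objects are bounded cochain complexes over `C`,
morphisms are morphisms of complexes up to chain homotopy. -/
abbrev BoundedHomotopyCategory := (bounded C).FullSubcategory

variable {C} {D : Type u₂} [Category.{v₂} D] [Preadditive D]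

/-- The functor `K^b(C) ⥤ K^b(D)` induced by an additive functor `F : C ⥤ D`, applying `F`
term by term. -/
def mapBoundedHomotopyCategory (F : C ⥤ D) [F.Additive] :
    BoundedHomotopyCategory C ⥤ BoundedHomotopyCategory D :=
  (bounded D).lift
    ((bounded C).ι ⋙ F.mapHomotopyCategory (ComplexShape.up ℤ))
    (fun K => by
      obtain ⟨a, b, h⟩ := K.property
      exact ⟨a, b, fun i hi => F.map_isZero (h i hi)⟩)

end Bounded

section WeakIdempotentCompletion

/-- The weak retraction-closure in `C` of a class `P` of objects: those `Z` such that
`X ⊞ Z ≅ Y` for some `X`, `Y` satisfying `P`. -/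
def weakRetractionClosure {C : Type u₁} [Category.{v₁} C] [Preadditive C] [HasFiniteBiproducts C]
    (P : ObjectProperty C) : ObjectProperty C :=
  fun Z => ∃ X Y : C, P X ∧ P Y ∧ Nonempty (X ⊞ Z ≅ Y)

variable (C : Type u₁) [Category.{v₁} C] [Preadditive C] [HasFiniteBiproducts C]

/-- The property defining the weak idempotent completion: the weak retraction-closure of (the
image `{(X, 𝟙 X)}` of) `C` in its idempotent completion `Karoubi C`. -/
def isWeakRetract : ObjectProperty (Karoubi C) :=
  weakRetractionClosure (ObjectProperty.ofObj (toKaroubi C).obj)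

/-- The weak idempotent completion of an additive category `C`, as a full subcategory of
the idempotent completion `Karoubi C`. -/
abbrev WeakIdempotentCompletion := (isWeakRetract C).FullSubcategory

lemma isWeakRetract_toKaroubi (X : C) : isWeakRetract C ((toKaroubi C).obj X) := by
  have := preservesBinaryBiproducts_of_preservesBiproducts (toKaroubi C)
  refine ⟨(toKaroubi C).obj X, (toKaroubi C).obj (X ⊞ X), ⟨_⟩, ⟨_⟩, ⟨?_⟩⟩
  exact ((toKaroubi C).mapBiprod X X).symm

/-- The canonical embedding of `C` into its weak idempotent completion, `X ↦ (X, 𝟙 X)`. -/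
def toWeakIdempotentCompletion : C ⥤ WeakIdempotentCompletion C :=
  (isWeakRetract C).lift (toKaroubi C) (isWeakRetract_toKaroubi C)

end WeakIdempotentCompletion

section SplitK0

variable (C : Type u₁) [Category.{v₁} C]

/-- The isomorphism classes of objects of `C`. -/
abbrev IsoClasses := Quotient (isIsomorphicSetoid C)

variable {C} in
/-- The isomorphism class of an object. -/
def isoClass (X : C) : IsoClasses C := Quotient.mk _ X

variable [Preadditive C] [HasFiniteBiproducts C]

/-- The subgroup of the free abelian group on isomorphism classes generated by the elements
`[Y] - [X] - [Z]` for `Y ≅ X ⊞ Z`. -/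
def splitRelations : AddSubgroup (FreeAbelianGroup (IsoClasses C)) :=
  AddSubgroup.closure
    { r | ∃ X Y Z : C, Nonempty (Y ≅ X ⊞ Z) ∧
      r = FreeAbelianGroup.of (isoClass Y) - FreeAbelianGroup.of (isoClass X)
        - FreeAbelianGroup.of (isoClass Z) }

/-- The split Grothendieck group `K_0^add(C)`. -/
abbrev SplitK0 := FreeAbelianGroup (IsoClasses C) ⧸ splitRelations C

variable {C} {D : Type u₂} [Category.{v₂} D]

/-- The map on isomorphism classes induced by a functor. -/
def mapIsoClasses (F : C ⥤ D) : IsoClasses C → IsoClasses D :=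
  Quotient.map F.obj (fun _ _ ⟨e⟩ => ⟨F.mapIso e⟩)

variable [Preadditive D] [HasFiniteBiproducts D]

/-- The homomorphism `K_0^add(C) → K_0^add(D)`, `[X] ↦ [F X]`, induced by an additive
functor `F`. -/
def mapSplitK0 (F : C ⥤ D) [F.Additive] : SplitK0 C →+ SplitK0 D :=
  QuotientAddGroup.map (splitRelations C) (splitRelations D)
    (FreeAbelianGroup.map (mapIsoClasses F)) (by
      rw [splitRelations, AddSubgroup.closure_le]
      rintro _ ⟨X, Y, Z, ⟨e⟩, rfl⟩
      refine AddSubgroup.subset_closure ⟨F.obj X, F.obj Y, F.obj Z, ⟨?_⟩, ?_⟩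
      · have := preservesBinaryBiproducts_of_preservesBiproducts F
        exact F.mapIso e ≪≫ F.mapBiprod X Z
      · simp only [map_sub, FreeAbelianGroup.map_of_apply]
        rfl)

end SplitK0

end WeakIdem

end

open WeakIdem

/-! The factorization through `Wkar(B)` exists, and `Kᵇ(F)` is an equivalence, exactly when `F`
is weakly dense: every `X'` in `B'` satisfies `F X ⊞ X' ≅ F Y` for some `X` and `Y`.

Suppose that `φ : F M ⟶ X'[0]` is a homotopy equivalence, with `M` bounded. Its mapping cone is a
bounded contractible complex `K`, and all its terms are in the image of `F`, except for
`K⁰ ≅ F M¹ ⊞ X'`. In the Karoubi envelope, contractibility splits `Kⁱ` into the objects of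
boundaries `Zⁱ ⊞ Zⁱ⁺¹`. The objects `Z` such that `F X ⊞ Z ≅ F Y` for some `X` and `Y` satisfy
cancellation, so, going inwards from both ends of the complex, they include all `Zⁱ` with `i ≤ 0`
and all `Zⁱ` with `i ≥ 1`. Hence they include `K⁰`, and then `X'`.

Conversely, suppose that `F Xⁱ ⊞ Kⁱ ≅ F Yⁱ` for the terms of a bounded complex `K`, and let `A` be
the complex with terms `F Xⁱ` and zero differential. Adding to `K` the contractible cone of the
identity of `A` makes all terms, now of the form `F Xⁱ⁺¹ ⊞ F Xⁱ ⊞ Kⁱ`, lie in the image of `F`.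

The inverse of `K₀(B) → K₀(B')` sends the class of `X'` to `[Y] - [X]` whenever `F X ⊞ X' ≅ F Y`.
-/

noncomputable section

namespace WeakIdem

attribute [local instance] hasBinaryBiproducts_of_finite_biproducts
attribute [local instance] preservesBinaryBiproducts_of_preservesBiproducts

section Biproducts

variable {C : Type u₁} [Category.{v₁} C] [Preadditive C] [HasFiniteBiproducts C]

/-- The canonical isomorphism `X ⊞ (Y ⊞ Z) ≅ Y ⊞ (X ⊞ Z)`. -/
def biprodLeftComm (X Y Z : C) : X ⊞ (Y ⊞ Z) ≅ Y ⊞ (X ⊞ Z) :=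
  (biprod.associator _ _ _).symm ≪≫ biprod.mapIso (biprod.braiding _ _) (Iso.refl _) ≪≫
    biprod.associator _ _ _

/-- The canonical isomorphism `(W ⊞ X) ⊞ (Y ⊞ Z) ≅ (W ⊞ Y) ⊞ (X ⊞ Z)`. -/
def biprodBiprodComm (W X Y Z : C) : (W ⊞ X) ⊞ (Y ⊞ Z) ≅ (W ⊞ Y) ⊞ (X ⊞ Z) :=
  biprod.associator _ _ _ ≪≫ biprod.mapIso (Iso.refl _) (biprodLeftComm _ _ _) ≪≫
    (biprod.associator _ _ _).symm

end Biproducts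

section WeakEssImage

variable {A : Type u₁} [Category.{v₁} A]
  {C : Type u₂} [Category.{v₂} C] [Preadditive C] [HasFiniteBiproducts C]

/-- The weak essential image of `F`: the objects `Z` such that `F X ⊞ Z ≅ F Y` for some `X` and
`Y`. For the embedding `toKaroubi C` this is, by definition, `isWeakRetract C`. -/
def weakEssImage (F : A ⥤ C) : ObjectProperty C :=
  weakRetractionClosure (ObjectProperty.ofObj F.obj)

/-- A functor is weakly dense if its weak essential image is the whole target. -/
def IsWeaklyDense (F : A ⥤ C) : Prop :=
  ∀ Z, weakEssImage F Z

lemma weakEssImage_iff {F : A ⥤ C} {Z : C} :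
    weakEssImage F Z ↔ ∃ X Y, Nonempty (F.obj X ⊞ Z ≅ F.obj Y) :=
  ⟨fun ⟨_, _, ⟨X⟩, ⟨Y⟩, e⟩ => ⟨X, Y, e⟩, fun ⟨X, Y, e⟩ => ⟨_, _, ⟨X⟩, ⟨Y⟩, e⟩⟩

instance (F : A ⥤ C) : (weakEssImage F).IsClosedUnderIsomorphisms where
  of_iso e := fun ⟨X, Y, hX, hY, ⟨φ⟩⟩ =>
    ⟨X, Y, hX, hY, ⟨biprod.mapIso (Iso.refl _) e.symm ≪≫ φ⟩⟩

lemma weakEssImage_of_natIso {F F' : A ⥤ C} (e : F ≅ F') {Z : C} (h : weakEssImage F Z) :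
    weakEssImage F' Z := by
  obtain ⟨X, Y, ⟨φ⟩⟩ := weakEssImage_iff.1 h
  exact weakEssImage_iff.2
    ⟨X, Y, ⟨biprod.mapIso (e.symm.app X) (Iso.refl _) ≪≫ φ ≪≫ e.app Y⟩⟩

lemma weakEssImage_comp_iff {D : Type*} [Category* D] [Preadditive D] [HasFiniteBiproducts D]
    (F : A ⥤ C) (H : C ⥤ D) [H.Additive] [H.Full] [H.Faithful] {Z : C} :
    weakEssImage (F ⋙ H) (H.obj Z) ↔ weakEssImage F Z := by
  simp only [weakEssImage_iff]
  exact exists₂_congr fun X Y =>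
    ⟨fun ⟨φ⟩ => ⟨H.preimageIso (H.mapBiprod _ _ ≪≫ φ)⟩,
      fun ⟨φ⟩ => ⟨(H.mapBiprod _ _).symm ≪≫ H.mapIso φ⟩⟩

variable [Preadditive A] [HasFiniteBiproducts A] (F : A ⥤ C) [F.Additive]

lemma weakEssImage_obj (X : A) : weakEssImage F (F.obj X) :=
  weakEssImage_iff.2 ⟨X, X ⊞ X, ⟨(F.mapBiprod X X).symm⟩⟩

lemma weakEssImage_of_isZero {Z : C} (hZ : IsZero Z) : weakEssImage F Z :=
  (weakEssImage F).prop_of_iso ((F.map_isZero (isZero_zero A)).iso hZ) (weakEssImage_obj F _)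

variable {F}

lemma weakEssImage_biprod {Z Z' : C} (h : weakEssImage F Z) (h' : weakEssImage F Z') :
    weakEssImage F (Z ⊞ Z') := by
  obtain ⟨X, Y, ⟨φ⟩⟩ := weakEssImage_iff.1 h
  obtain ⟨X', Y', ⟨φ'⟩⟩ := weakEssImage_iff.1 h'
  exact weakEssImage_iff.2 ⟨X ⊞ X', Y ⊞ Y', ⟨biprod.mapIso (F.mapBiprod _ _) (Iso.refl _) ≪≫
    biprodBiprodComm _ _ _ _ ≪≫ biprod.mapIso φ φ' ≪≫ (F.mapBiprod _ _).symm⟩⟩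

lemma weakEssImage_of_biprod_left {Z Z' : C} (hZ : weakEssImage F Z)
    (h : weakEssImage F (Z ⊞ Z')) : weakEssImage F Z' := by
  obtain ⟨X, Y, ⟨φ⟩⟩ := weakEssImage_iff.1 hZ
  obtain ⟨X', Y', ⟨φ'⟩⟩ := weakEssImage_iff.1 h
  exact weakEssImage_iff.2 ⟨X' ⊞ Y, X ⊞ Y', ⟨biprod.mapIso (F.mapBiprod _ _) (Iso.refl _) ≪≫
    biprod.associator _ _ _ ≪≫
    biprod.mapIso (Iso.refl _)
      (biprod.mapIso φ.symm (Iso.refl _) ≪≫ biprod.associator _ _ _) ≪≫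
    biprodLeftComm _ _ _ ≪≫ biprod.mapIso (Iso.refl _) φ' ≪≫ (F.mapBiprod _ _).symm⟩⟩

lemma weakEssImage_of_biprod_right {Z Z' : C} (hZ' : weakEssImage F Z')
    (h : weakEssImage F (Z ⊞ Z')) : weakEssImage F Z :=
  weakEssImage_of_biprod_left hZ' ((weakEssImage F).prop_of_iso (biprod.braiding _ _) h)

end WeakEssImage

section Factorization

variable {B : Type u₁} [Category.{v₁} B] {B' : Type u₂} [Category.{v₂} B']

instance (F : B ⥤ B') [F.Full] [F.Faithful] [IsIdempotentComplete B] :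
    F.essImage.IsStableUnderRetracts where
  of_retract {X _} r := by
    rintro ⟨Y, ⟨φ⟩⟩
    let ρ : Retract X (F.obj Y) := r.trans (.ofIso φ.symm)
    obtain ⟨Z, i, p, hip, hpi⟩ := IsIdempotentComplete.idempotents_split Y
      (F.preimage (ρ.r ≫ ρ.i)) (F.map_injective (by simp))
    have hip' : F.map i ≫ F.map p = 𝟙 _ := by rw [← F.map_comp, hip, F.map_id]
    have hpi' : F.map p ≫ F.map i = ρ.r ≫ ρ.i := by rw [← F.map_comp, hpi, F.map_preimage]
    refine ⟨Z, ⟨⟨F.map i ≫ ρ.r, ρ.i ≫ F.map p, ?_, ?_⟩⟩⟩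
    · rw [Category.assoc, ← reassoc_of% hpi', hip', Category.comp_id, hip']
    · rw [Category.assoc, reassoc_of% hpi', ρ.retract, Category.comp_id, ρ.retract]

/-- The functor between Karoubi envelopes induced by `F`. -/
abbrev mapKaroubi (F : B ⥤ B') : Karoubi B ⥤ Karoubi B' := (functorExtension₂ B B').obj F

instance (F : B ⥤ B') [F.Faithful] : (mapKaroubi F).Faithful where
  map_injective h := by
    ext
    exact F.map_injective (congrArg Karoubi.Hom.f h)

instance (F : B ⥤ B') [F.Full] [F.Faithful] : (mapKaroubi F).Full where
  map_surjective {P Q} f := by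
    obtain ⟨φ, hφ⟩ := F.map_surjective f.f
    refine ⟨⟨φ, F.map_injective ?_⟩, by ext; exact hφ⟩
    rw [F.map_comp, F.map_comp, hφ]
    exact f.comm

/-- The embeddings into Karoubi envelopes are natural with respect to the functor `F`. -/
def toKaroubiCompMapKaroubi (F : B ⥤ B') : toKaroubi B ⋙ mapKaroubi F ≅ F ⋙ toKaroubi B' :=
  (functorExtension₂CompWhiskeringLeftToKaroubiIso B B').app F

lemma exists_comp_mapKaroubi_iso (F : B ⥤ B') [F.Full] [F.Faithful]
    (h : ∀ X', (mapKaroubi F).essImage ((toKaroubi B').obj X')) :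
    ∃ G : B' ⥤ Karoubi B, G.Full ∧ G.Faithful ∧
      Nonempty (G ⋙ mapKaroubi F ≅ toKaroubi B') ∧ Nonempty (F ⋙ G ≅ toKaroubi B) := by
  let G := Functor.essImage.liftFunctor (toKaroubi B') (mapKaroubi F) h
  let e : G ⋙ mapKaroubi F ≅ toKaroubi B' := Functor.essImage.liftFunctorCompIso _ _ h
  let cancel := (Functor.FullyFaithful.ofFullyFaithful (mapKaroubi F)).whiskeringRight B
  exact ⟨G, .of_comp_faithful_iso e, .of_comp_iso e, ⟨e⟩,
    ⟨cancel.preimageIso (Functor.isoWhiskerLeft F e ≪≫ (toKaroubiCompMapKaroubi F).symm)⟩⟩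

variable [Preadditive B']

lemma essImage_mapKaroubi_of_weakEssImage [HasFiniteBiproducts B'] {F : B ⥤ B'} [F.Full]
    [F.Faithful] {X' : B'} (h : weakEssImage F X') :
    (mapKaroubi F).essImage ((toKaroubi B').obj X') := by
  obtain ⟨X, Y, ⟨φ⟩⟩ := weakEssImage_iff.1 h
  let r : Retract X' (F.obj Y) := ⟨biprod.inr ≫ φ.hom, φ.inv ≫ biprod.snd, by simp⟩
  exact (mapKaroubi F).essImage.prop_of_retract (r.map (toKaroubi B'))
    ⟨(toKaroubi B).obj Y, ⟨(toKaroubiCompMapKaroubi F).app Y⟩⟩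

variable [Preadditive B]

instance (F : B ⥤ B') [F.Additive] : (mapKaroubi F).Additive where
  map_add := by
    intros
    ext
    exact F.map_add

variable [HasFiniteBiproducts B] [HasFiniteBiproducts B']

lemma isWeaklyDense_of_factorization {F : B ⥤ B'} (G : B' ⥤ WeakIdempotentCompletion B)
    [G.Additive] [G.Full] [G.Faithful] (e : F ⋙ G ≅ toWeakIdempotentCompletion B) :
    IsWeaklyDense F := by
  intro X'
  let H : B' ⥤ Karoubi B := G ⋙ (isWeakRetract B).ι
  have eH : toKaroubi B ≅ F ⋙ H := Functor.isoWhiskerRight e.symm (isWeakRetract B).ι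
  exact (weakEssImage_comp_iff F H).1 (weakEssImage_of_natIso eH (G.obj X').property)

variable {F : B ⥤ B'} [F.Additive] [F.Full] [F.Faithful]

lemma isWeakRetract_of_mapKaroubi_iso {X' : B'} (h : weakEssImage F X') {P : Karoubi B}
    (e : (mapKaroubi F).obj P ≅ (toKaroubi B').obj X') : isWeakRetract B P := by
  refine (weakEssImage_comp_iff (toKaroubi B) (mapKaroubi F)).1 ?_
  refine weakEssImage_of_natIso (toKaroubiCompMapKaroubi F).symm ?_
  exact (weakEssImage _).prop_of_iso e.symm ((weakEssImage_comp_iff F (toKaroubi B')).2 h)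

lemma exists_factorization_of_isWeaklyDense (hF : IsWeaklyDense F) :
    ∃ G : B' ⥤ WeakIdempotentCompletion B,
      G.Additive ∧ G.Full ∧ G.Faithful ∧ Nonempty (F ⋙ G ≅ toWeakIdempotentCompletion B) := by
  obtain ⟨G, _, _, ⟨e⟩, ⟨ε⟩⟩ := exists_comp_mapKaroubi_iso F fun X' =>
    essImage_mapKaroubi_of_weakEssImage (hF X')
  have : (G ⋙ mapKaroubi F).Additive := Functor.additive_of_iso e.symm
  have : G.Additive := Functor.additive_of_comp_faithful G (mapKaroubi F)
  let ι := (isWeakRetract B).fullyFaithfulι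
  exact ⟨(isWeakRetract B).lift G fun X' => isWeakRetract_of_mapKaroubi_iso (hF X') (e.app X'),
    ⟨ι.map_injective G.map_add⟩, inferInstance, inferInstance,
    ⟨(ι.whiskeringRight B).preimageIso ε⟩⟩

end Factorization

section KaroubiBoundaries

variable {C : Type u₁} [Category.{v₁} C]

/-- Idempotents of the form `u ≫ v` and `v ≫ u` have isomorphic images. -/
def karoubiIsoOfCompEq {P Q : Karoubi C} (u : P.X ⟶ Q.X) (v : Q.X ⟶ P.X)
    (huv : u ≫ v = P.p) (hvu : v ≫ u = Q.p) : P ≅ Q where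
  hom := ⟨P.p ≫ u, by simp [← hvu, reassoc_of% huv]⟩
  inv := ⟨Q.p ≫ v, by simp [← huv, reassoc_of% hvu]⟩
  hom_inv_id := by
    ext
    simp [← hvu, reassoc_of% huv, huv]
  inv_hom_id := by
    ext
    simp [← huv, reassoc_of% hvu, hvu]

variable [Preadditive C] {ι : Type*} {c : ComplexShape ι} {K : HomologicalComplex C c}

/-- The boundaries of a contractible complex: the image, in the Karoubi envelope, of the
idempotent endomorphism `h ≫ d` of `K.X i`, where `h` is the contracting homotopy. -/
def karoubiBoundaries (h : Homotopy (𝟙 K) 0) (i : ι) : Karoubi C where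
  X := K.X i
  p := prevD i h.hom
  idem := by
    have hpq : prevD i h.hom ≫ dNext i h.hom = 0 := by simp [prevD, dNext]
    have hid : dNext i h.hom + prevD i h.hom = 𝟙 _ := by simpa using (h.comm i).symm
    rw [← add_zero (_ ≫ _), ← hpq, ← Preadditive.comp_add, add_comm, hid, Category.comp_id]

lemma nonempty_iso_biprod_karoubiBoundaries [HasFiniteBiproducts C] (h : Homotopy (𝟙 K) 0)
    {i j : ι} (hij : c.Rel i j) :
    Nonempty (karoubiBoundaries h i ⊞ karoubiBoundaries h j ≅ (toKaroubi C).obj (K.X i)) := by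
  have hd : K.d i j ≫ h.hom j i = 𝟙 _ - prevD i h.hom := by
    rw [← dNext_eq _ hij, eq_sub_iff_add_eq]
    simpa using (h.comm i).symm
  let e : (karoubiBoundaries h i).complement ≅ karoubiBoundaries h j :=
    karoubiIsoOfCompEq (K.d i j) (h.hom j i) hd (prevD_eq _ hij).symm
  exact ⟨biprod.mapIso (Iso.refl _) e.symm ≪≫ Karoubi.decomposition _⟩

end KaroubiBoundaries

section Contractible

variable {A : Type u₁} [Category.{v₁} A] [Preadditive A] [HasFiniteBiproducts A]
  {C : Type u₂} [Category.{v₂} C] [Preadditive C] [HasFiniteBiproducts C]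
  {F : A ⥤ C} [F.Additive] {K : CochainComplex C ℤ}

lemma weakEssImage_karoubiBoundaries_succ_iff (h : Homotopy (𝟙 K) 0) {i : ℤ}
    (hi : weakEssImage F (K.X i)) :
    weakEssImage (F ⋙ toKaroubi C) (karoubiBoundaries h (i + 1)) ↔
      weakEssImage (F ⋙ toKaroubi C) (karoubiBoundaries h i) := by
  obtain ⟨e⟩ := nonempty_iso_biprod_karoubiBoundaries h (i := i) (j := i + 1) (by simp)
  have hsum := (weakEssImage _).prop_of_iso e.symm ((weakEssImage_comp_iff F (toKaroubi C)).2 hi)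
  exact ⟨(weakEssImage_of_biprod_right · hsum), (weakEssImage_of_biprod_left · hsum)⟩

lemma weakEssImage_karoubiBoundaries_of_isZero (h : Homotopy (𝟙 K) 0) {i : ℤ}
    (hi : IsZero (K.X i)) : weakEssImage (F ⋙ toKaroubi C) (karoubiBoundaries h i) := by
  obtain ⟨e⟩ := nonempty_iso_biprod_karoubiBoundaries h (i := i) (j := i + 1) (by simp)
  have hsum := ((toKaroubi C).map_isZero hi).of_iso e
  exact weakEssImage_of_isZero _ ((biprod_isZero_iff _ _).1 hsum).1

lemma weakEssImage_karoubiBoundaries_of_lt (h : Homotopy (𝟙 K) 0) {a n : ℤ}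
    (ha : ∀ i < a, IsZero (K.X i)) (hn : ∀ i < n, weakEssImage F (K.X i)) :
    weakEssImage (F ⋙ toKaroubi C) (karoubiBoundaries h n) := by
  suffices H : ∀ i, min (a - 1) n ≤ i → i ≤ n →
      weakEssImage (F ⋙ toKaroubi C) (karoubiBoundaries h i) from H n (min_le_right _ _) le_rfl
  intro i hi
  induction i, hi using Int.leInduction with
  | base => exact fun _ => weakEssImage_karoubiBoundaries_of_isZero h (ha _ (by omega))
  | succ i _ ih =>
    exact fun hin => (weakEssImage_karoubiBoundaries_succ_iff h (hn i (by omega))).2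
      (ih (by omega))

lemma weakEssImage_karoubiBoundaries_of_ge (h : Homotopy (𝟙 K) 0) {b n : ℤ}
    (hb : ∀ i > b, IsZero (K.X i)) (hn : ∀ i ≥ n, weakEssImage F (K.X i)) :
    weakEssImage (F ⋙ toKaroubi C) (karoubiBoundaries h n) := by
  suffices H : ∀ i, i ≤ max (b + 1) n → n ≤ i →
      weakEssImage (F ⋙ toKaroubi C) (karoubiBoundaries h i) from H n (le_max_right _ _) le_rfl
  intro i hi
  induction i, hi using Int.leInductionDown with
  | base => exact fun _ => weakEssImage_karoubiBoundaries_of_isZero h (hb _ (by omega))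
  | pred i _ ih =>
    intro hni
    obtain ⟨j, rfl⟩ : ∃ j, i = j + 1 := ⟨i - 1, by omega⟩
    rw [add_sub_cancel_right] at hni ⊢
    exact (weakEssImage_karoubiBoundaries_succ_iff h (hn j hni)).1 (ih (by omega))

lemma weakEssImage_X_of_contractible
    (hK : bounded C ((HomotopyCategory.quotient C (.up ℤ)).obj K)) (h : Homotopy (𝟙 K) 0) {n : ℤ}
    (hn : ∀ i ≠ n, weakEssImage F (K.X i)) : weakEssImage F (K.X n) := by
  obtain ⟨a, b, hab⟩ := hK
  obtain ⟨e⟩ := nonempty_iso_biprod_karoubiBoundaries h (i := n) (j := n + 1) (by simp)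
  have hZ : weakEssImage (F ⋙ toKaroubi C) (karoubiBoundaries h n) :=
    weakEssImage_karoubiBoundaries_of_lt h (fun i hi => hab i (.inl hi))
      fun i hi => hn i (by omega)
  have hZ' : weakEssImage (F ⋙ toKaroubi C) (karoubiBoundaries h (n + 1)) :=
    weakEssImage_karoubiBoundaries_of_ge h (fun i hi => hab i (.inr hi))
      fun i hi => hn i (by omega)
  exact (weakEssImage_comp_iff F (toKaroubi C)).1
    ((weakEssImage _).prop_of_iso e (weakEssImage_biprod hZ hZ'))

lemma nonempty_homotopy_id_mappingCone_zero {K L : CochainComplex C ℤ} (φ : K ⟶ L)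
    [IsIso ((HomotopyCategory.quotient C (.up ℤ)).map φ)] :
    Nonempty (Homotopy (𝟙 (CochainComplex.mappingCone φ)) 0) :=
  (HomotopyCategory.isZero_quotient_obj_iff _).1 <|
    Pretriangulated.Triangle.isZero₃_of_isIso₁ _
      (HomotopyCategory.mappingCone_triangleh_distinguished φ) ‹_›

lemma weakEssImage_X_of_isIso_quotient_map {K L : CochainComplex C ℤ} (φ : K ⟶ L)
    [IsIso ((HomotopyCategory.quotient C (.up ℤ)).map φ)]
    (hK : bounded C ((HomotopyCategory.quotient C (.up ℤ)).obj K))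
    (hL : bounded C ((HomotopyCategory.quotient C (.up ℤ)).obj L)) {n : ℤ}
    (hKn : ∀ i, weakEssImage F (K.X i)) (hLn : ∀ i ≠ n, weakEssImage F (L.X i)) :
    weakEssImage F (L.X n) := by
  obtain ⟨a, b, hab⟩ := hK
  obtain ⟨a', b', hab'⟩ := hL
  obtain ⟨h⟩ := nonempty_homotopy_id_mappingCone_zero φ
  let e (i : ℤ) : (CochainComplex.mappingCone φ).X i ≅ K.X (i + 1) ⊞ L.X i :=
    HomologicalComplex.homotopyCofiber.XIsoBiprod φ i (i + 1) (by simp)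
  have hcone : weakEssImage F ((CochainComplex.mappingCone φ).X n) := by
    refine weakEssImage_X_of_contractible ⟨min (a - 1) a', max b b', fun i hi => ?_⟩ h fun i hi =>
      (weakEssImage F).prop_of_iso (e i).symm (weakEssImage_biprod (hKn (i + 1)) (hLn i hi))
    exact ((biprod_isZero_iff _ _).2 ⟨hab _ (by omega), hab' _ (by omega)⟩).of_iso (e i)
  exact weakEssImage_of_biprod_left (hKn (n + 1)) ((weakEssImage F).prop_of_iso (e n) hcone)

end Contractible

section HomologicalComplex

variable {C : Type u₁} [Category.{v₁} C] [Preadditive C]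

lemma nonempty_quotient_biprod_iso [HasFiniteBiproducts C] (K : CochainComplex C ℤ)
    {L : CochainComplex C ℤ} (h : Homotopy (𝟙 L) 0) :
    Nonempty ((HomotopyCategory.quotient C (.up ℤ)).obj (K ⊞ L) ≅
      (HomotopyCategory.quotient C (.up ℤ)).obj K) :=
  have hL := (HomotopyCategory.isZero_quotient_obj_iff L).2 ⟨h⟩
  ⟨(HomotopyCategory.quotient C (.up ℤ)).mapBiprod K L ≪≫ (isoBiprodZero hL).symm⟩

variable {D : Type u₂} [Category.{v₂} D] [Preadditive D] {F : C ⥤ D} [F.Full] [F.Faithful]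

lemma exists_mapHomologicalComplex_iso [F.Additive] {ι : Type*} {c : ComplexShape ι}
    (K : HomologicalComplex D c) {X : ι → C} (φ : ∀ i, F.obj (X i) ≅ K.X i) :
    ∃ L : HomologicalComplex C c, (∀ i, L.X i = X i) ∧
      Nonempty ((F.mapHomologicalComplex c).obj L ≅ K) := by
  let L : HomologicalComplex C c :=
    { X := X
      d := fun i j => F.preimage ((φ i).hom ≫ K.d i j ≫ (φ j).inv)
      shape := fun i j hij => F.map_injective (by simp [K.shape i j hij])
      d_comp_d' := fun i j k _ _ => F.map_injective (by simp) }
  refine ⟨L, fun _ => rfl, ⟨HomologicalComplex.Hom.isoOfComponents φ fun i j _ => ?_⟩⟩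
  change (φ i).hom ≫ K.d i j = F.map (F.preimage _) ≫ (φ j).hom
  simp

end HomologicalComplex

section BoundedHomotopyCategory

variable {B : Type u₁} [Category.{v₁} B] [Preadditive B] [HasFiniteBiproducts B]
  {B' : Type u₂} [Category.{v₂} B'] [Preadditive B'] [HasFiniteBiproducts B']
  {F : B ⥤ B'} [F.Additive]

lemma isWeaklyDense_of_essSurj [(mapBoundedHomotopyCategory F).EssSurj] : IsWeaklyDense F := by
  intro X'
  let S : CochainComplex B' ℤ := (HomologicalComplex.single B' (.up ℤ) 0).obj X'
  have hS (i : ℤ) (hi : i ≠ 0) : IsZero (S.X i) :=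
    HomologicalComplex.isZero_single_obj_X _ _ _ _ hi
  have hSb : bounded B' ((HomotopyCategory.quotient B' (.up ℤ)).obj S) :=
    ⟨0, 0, fun i hi => hS i (by omega)⟩
  let M := (mapBoundedHomotopyCategory F).objPreimage ⟨_, hSb⟩
  let e := (bounded B').ι.mapIso ((mapBoundedHomotopyCategory F).objObjPreimageIso ⟨_, hSb⟩)
  obtain ⟨φ, hφ⟩ := (HomotopyCategory.quotient B' (.up ℤ)).map_surjective
    (X := (F.mapHomologicalComplex (.up ℤ)).obj M.obj.as) (Y := S) e.hom
  have : IsIso ((HomotopyCategory.quotient B' (.up ℤ)).map φ) := hφ ▸ e.isIso_hom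
  have hS₀ : weakEssImage F (S.X 0) :=
    weakEssImage_X_of_isIso_quotient_map φ ((mapBoundedHomotopyCategory F).obj M).property hSb
      (fun i => weakEssImage_obj F _) fun i hi => weakEssImage_of_isZero F (hS i hi)
  exact (weakEssImage F).prop_of_iso (HomologicalComplex.singleObjXSelf (.up ℤ) 0 X') hS₀

lemma exists_biprod_iso_of_isWeaklyDense (hF : IsWeaklyDense F) (X' : B') :
    ∃ X Y : B, Nonempty (F.obj X ⊞ X' ≅ F.obj Y) ∧ (IsZero X' → IsZero X ∧ IsZero Y) := by
  by_cases h : IsZero X'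
  · obtain ⟨O, hO⟩ := HasZeroObject.zero (C := B)
    have hFO : IsZero (F.obj O) := F.map_isZero hO
    exact ⟨O, O, ⟨((biprod_isZero_iff _ _).2 ⟨hFO, h⟩).iso hFO⟩, fun _ => ⟨hO, hO⟩⟩
  · obtain ⟨X, Y, e⟩ := weakEssImage_iff.1 (hF X')
    exact ⟨X, Y, e, fun h' => absurd h' h⟩

variable [F.Full] [F.Faithful]

lemma essSurj_mapBoundedHomotopyCategory (hF : IsWeaklyDense F) :
    (mapBoundedHomotopyCategory F).EssSurj := by
  refine ⟨fun ⟨K, a, b, hK⟩ => ?_⟩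
  obtain ⟨K, rfl⟩ := HomotopyCategory.quotient_obj_surjective K
  choose X Y φ hXY using fun i => exists_biprod_iso_of_isWeaklyDense hF (K.X i)
  let A : CochainComplex B' ℤ := { X := fun i => F.obj (X i), d := fun _ _ => 0 }
  let ψ (i : ℤ) : F.obj (X (i + 1) ⊞ Y i) ≅ (K ⊞ CochainComplex.mappingCone (𝟙 A)).X i :=
    F.mapBiprod _ _ ≪≫ biprod.mapIso (Iso.refl _) (φ i).some.symm ≪≫
      (biprod.associator _ _ _).symm ≪≫ biprod.braiding _ _ ≪≫
      biprod.mapIso (Iso.refl _)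
        (HomologicalComplex.homotopyCofiber.XIsoBiprod (𝟙 A) i (i + 1) (by simp)).symm ≪≫
      (HomologicalComplex.biprodXIso K (CochainComplex.mappingCone (𝟙 A)) i).symm
  obtain ⟨L, hL, ⟨e⟩⟩ := exists_mapHomologicalComplex_iso _ ψ
  obtain ⟨q⟩ :=
    nonempty_quotient_biprod_iso K (CochainComplex.mappingCone.homotopyToZeroOfId A)
  refine ⟨⟨(HomotopyCategory.quotient B _).obj L, a - 1, b, fun i hi => ?_⟩,
    ⟨(bounded B').isoMk ((HomotopyCategory.quotient B' _).mapIso e ≪≫ q)⟩⟩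
  have hXY' : IsZero (X (i + 1) ⊞ Y i) :=
    (biprod_isZero_iff _ _).2 ⟨(hXY (i + 1) (hK _ (by omega))).1, (hXY i (hK i (by omega))).2⟩
  exact hL i ▸ hXY'

variable (F) in
lemma isEquivalence_mapBoundedHomotopyCategory_iff :
    (mapBoundedHomotopyCategory F).IsEquivalence ↔ IsWeaklyDense F := by
  have full : (mapBoundedHomotopyCategory F).Full := by
    unfold mapBoundedHomotopyCategory
    infer_instance
  have faithful : (mapBoundedHomotopyCategory F).Faithful := by
    unfold mapBoundedHomotopyCategory
    infer_instance
  exact ⟨fun _ => isWeaklyDense_of_essSurj, fun hF =>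
    { essSurj := essSurj_mapBoundedHomotopyCategory hF }⟩

end BoundedHomotopyCategory

section SplitK0

variable {B : Type u₁} [Category.{v₁} B] [Preadditive B] [HasFiniteBiproducts B]

/-- The class of an object in the split Grothendieck group. -/
def SplitK0.of (X : B) : SplitK0 B :=
  QuotientAddGroup.mk (FreeAbelianGroup.of (isoClass X))

lemma SplitK0.of_eq_of_iso {X Y : B} (e : X ≅ Y) : SplitK0.of X = SplitK0.of Y :=
  congrArg (fun x => (QuotientAddGroup.mk (FreeAbelianGroup.of x) : SplitK0 B))
    (Quotient.sound ⟨e⟩)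

lemma SplitK0.of_biprod (X Y : B) : SplitK0.of (X ⊞ Y) = SplitK0.of X + SplitK0.of Y := by
  rw [SplitK0.of, SplitK0.of, SplitK0.of, ← QuotientAddGroup.mk_add, QuotientAddGroup.eq,
    ← neg_mem_iff]
  refine AddSubgroup.subset_closure ⟨X, X ⊞ Y, Y, ⟨Iso.refl _⟩, ?_⟩
  abel

lemma SplitK0.hom_ext {A : Type*} [AddCommGroup A] {f g : SplitK0 B →+ A}
    (h : ∀ X, f (SplitK0.of X) = g (SplitK0.of X)) : f = g := by
  refine QuotientAddGroup.addMonoidHom_ext _ (FreeAbelianGroup.lift_ext _ _ ?_)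
  rintro ⟨X⟩
  exact h X

/-- The homomorphism out of the split Grothendieck group induced by an isomorphism invariant of
objects which is additive on biproducts. -/
def SplitK0.lift {A : Type*} [AddCommGroup A] (f : B → A)
    (hf : ∀ X Y, Nonempty (X ≅ Y) → f X = f Y) (hf' : ∀ X Y, f (X ⊞ Y) = f X + f Y) :
    SplitK0 B →+ A :=
  QuotientAddGroup.lift _ (FreeAbelianGroup.lift (Quotient.lift f hf)) (by
    rw [splitRelations, AddSubgroup.closure_le]
    rintro _ ⟨X, Y, Z, e, rfl⟩
    change FreeAbelianGroup.lift (Quotient.lift f hf) _ = 0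
    simp only [map_sub, FreeAbelianGroup.lift_apply_of]
    change f Y - f X - f Z = 0
    rw [hf _ _ e, hf', add_sub_cancel_left, sub_self])

lemma SplitK0.lift_of {A : Type*} [AddCommGroup A] (f : B → A)
    (hf : ∀ X Y, Nonempty (X ≅ Y) → f X = f Y) (hf' : ∀ X Y, f (X ⊞ Y) = f X + f Y) (X : B) :
    SplitK0.lift f hf hf' (SplitK0.of X) = f X :=
  FreeAbelianGroup.lift_apply_of _ _

variable {B' : Type u₂} [Category.{v₂} B'] [Preadditive B'] [HasFiniteBiproducts B']
  {F : B ⥤ B'} [F.Additive]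

lemma mapSplitK0_of (X : B) : mapSplitK0 F (SplitK0.of X) = SplitK0.of (F.obj X) := rfl

lemma mapSplitK0_of_sub_of {X Y : B} {Z : B'} (e : F.obj X ⊞ Z ≅ F.obj Y) :
    mapSplitK0 F (SplitK0.of Y - SplitK0.of X) = SplitK0.of Z := by
  rw [map_sub, mapSplitK0_of, mapSplitK0_of, ← SplitK0.of_eq_of_iso e, SplitK0.of_biprod,
    add_sub_cancel_left]

variable [F.Full] [F.Faithful]

lemma SplitK0.of_sub_of_eq {X₁ X₂ Y₁ Y₂ : B} {Z : B'} (e₁ : F.obj X₁ ⊞ Z ≅ F.obj Y₁)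
    (e₂ : F.obj X₂ ⊞ Z ≅ F.obj Y₂) :
    SplitK0.of Y₁ - SplitK0.of X₁ = SplitK0.of Y₂ - SplitK0.of X₂ := by
  let e : X₁ ⊞ Y₂ ≅ X₂ ⊞ Y₁ := F.preimageIso <|
    F.mapBiprod _ _ ≪≫ biprod.mapIso (Iso.refl _) e₂.symm ≪≫ biprodLeftComm _ _ _ ≪≫
      biprod.mapIso (Iso.refl _) e₁ ≪≫ (F.mapBiprod _ _).symm
  have h : SplitK0.of X₁ + SplitK0.of Y₂ = SplitK0.of X₂ + SplitK0.of Y₁ := by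
    rw [← SplitK0.of_biprod, ← SplitK0.of_biprod, SplitK0.of_eq_of_iso e]
  rw [sub_eq_sub_iff_add_eq_add, add_comm, ← h, add_comm]

lemma exists_splitK0_hom_of_isWeaklyDense (hF : IsWeaklyDense F) :
    ∃ g : SplitK0 B' →+ SplitK0 B, ∀ (X Y : B) (Z : B'), (F.obj X ⊞ Z ≅ F.obj Y) →
      g (SplitK0.of Z) = SplitK0.of Y - SplitK0.of X := by
  choose X Y φ using fun Z => weakEssImage_iff.1 (hF Z)
  let f (Z : B') : SplitK0 B := SplitK0.of (Y Z) - SplitK0.of (X Z)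
  have f_eq {X' Y' : B} {Z : B'} (e : F.obj X' ⊞ Z ≅ F.obj Y') :
      f Z = SplitK0.of Y' - SplitK0.of X' := SplitK0.of_sub_of_eq (φ Z).some e
  have f_iso (Z Z' : B') : Nonempty (Z ≅ Z') → f Z = f Z' := fun ⟨e⟩ =>
    f_eq (biprod.mapIso (Iso.refl _) e ≪≫ (φ Z').some)
  have f_biprod (Z Z' : B') : f (Z ⊞ Z') = f Z + f Z' := by
    let e : F.obj (X Z ⊞ X Z') ⊞ (Z ⊞ Z') ≅ F.obj (Y Z ⊞ Y Z') :=
      biprod.mapIso (F.mapBiprod _ _) (Iso.refl _) ≪≫ biprodBiprodComm _ _ _ _ ≪≫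
        biprod.mapIso (φ Z).some (φ Z').some ≪≫ (F.mapBiprod _ _).symm
    rw [f_eq e, SplitK0.of_biprod, SplitK0.of_biprod, add_sub_add_comm]
  exact ⟨SplitK0.lift f f_iso f_biprod, fun X Y Z e => (SplitK0.lift_of _ _ _ Z).trans (f_eq e)⟩

lemma bijective_mapSplitK0_of_isWeaklyDense (hF : IsWeaklyDense F) :
    Function.Bijective (mapSplitK0 F) := by
  obtain ⟨g, hg⟩ := exists_splitK0_hom_of_isWeaklyDense hF
  have left_inv : g.comp (mapSplitK0 F) = AddMonoidHom.id _ := SplitK0.hom_ext fun X => by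
    rw [AddMonoidHom.comp_apply, mapSplitK0_of, hg X (X ⊞ X) _ (F.mapBiprod X X).symm,
      SplitK0.of_biprod, add_sub_cancel_left, AddMonoidHom.id_apply]
  have right_inv : (mapSplitK0 F).comp g = AddMonoidHom.id _ := SplitK0.hom_ext fun Z => by
    obtain ⟨X, Y, ⟨e⟩⟩ := weakEssImage_iff.1 (hF Z)
    rw [AddMonoidHom.comp_apply, hg X Y Z e, mapSplitK0_of_sub_of e, AddMonoidHom.id_apply]
  exact Function.bijective_iff_has_inverse.2
    ⟨g, DFunLike.congr_fun left_inv, DFunLike.congr_fun right_inv⟩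

end SplitK0

end WeakIdem

end

theorem corollary4p3
    {B : Type u₁} [Category.{v₁} B] [Preadditive B] [HasFiniteBiproducts B]
    {B' : Type u₂} [Category.{v₂} B'] [Preadditive B'] [HasFiniteBiproducts B']
    (F : B ⥤ B') [F.Additive] [F.Full] [F.Faithful] :
    ((mapBoundedHomotopyCategory F).IsEquivalence ↔
      ∃ G : B' ⥤ WeakIdempotentCompletion B,
        G.Additive ∧ G.Full ∧ G.Faithful ∧ Nonempty (F ⋙ G ≅ toWeakIdempotentCompletion B)) ∧
    (EssentiallySmall.{w} B' →
      (∃ G : B' ⥤ WeakIdempotentCompletion B,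
        G.Additive ∧ G.Full ∧ G.Faithful ∧ Nonempty (F ⋙ G ≅ toWeakIdempotentCompletion B)) →
      Function.Bijective (mapSplitK0 F)) := by
  have h : IsWeaklyDense F ↔ ∃ G : B' ⥤ WeakIdempotentCompletion B,
      G.Additive ∧ G.Full ∧ G.Faithful ∧ Nonempty (F ⋙ G ≅ toWeakIdempotentCompletion B) :=
    ⟨exists_factorization_of_isWeaklyDense, fun ⟨G, _, _, _, ⟨e⟩⟩ =>
      isWeaklyDense_of_factorization G e⟩
  exact ⟨(isEquivalence_mapBoundedHomotopyCategory_iff F).trans h, fun _ hG =>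
    bijective_mapSplitK0_of_isWeaklyDense (h.2 hG)⟩
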